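/- **Setting.** Let $\mathbb X=(X_n)_{n\ge1}$ be a strictly stationary sequence of (real) random variables on a probability space $(\Omega,\mathcal F,\mathbb P)$, let $a>0$ be a real number, and let $(k_n)_{n\ge1}$ be integers with $1\le k_n\le n$ for all $n\ge 1$ and $k_n/n\to1$ as $n\to\infty$. Write $X_{1:n}\le\dots\le X_{n:n}$ for the order statistics of $X_1,\dots,X_n$, and $I(\cdot)$ for indicators. Let $\mathcal I^{\mathbb X}$ be the sigma-field of all sets $A\subset\Omega$ for which there is a Borel set $B\subset\mathbb R^{\mathbb N}$ with $A=\{\omega:(X_i(\omega),X_{i+1}(\omega),\dots)\in B\}$ for every $i\ge1$. For a random variable $Y$ and a sigma-field $\mathcal G\subset\mathcal F$, the conditional right endpoint $\gamma_1(Y|\mathcal G)$ is the (almost surely unique) $\mathcal G$-measurable function $\Omega\to[-\infty,\infty]$ such that $\mathbb P(Y\le\gamma_1(Y|\mathcal G)\,|\,\mathcal G)=1$ a.s. and such that every $\mathcal G$-measurable $Q:\Omega\to[-\infty,\infty]$ with $\mathbb P(Y\le Q\,|\,\mathcal G)=1$ a.s. satisfies $Q\ge\gamma_1(Y|\mathcal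 G)$ a.s. Put $$S(k_n,n,a)=\sum_{i=1}^n X_i\, I(X_{k_n:n}-a<X_i<X_{k_n:n}),$$ and, for a process $(N(t),t\ge0)$ of non-negative integer-valued random variables, $$\mathcal S_t(k_{N(t)},a)=\sum_{i=1}^{N(t)} X_i\, I(X_{k_{N(t)}:N(t)}-a<X_i<X_{k_{N(t)}:N(t)}).$$ **Theorem.** Suppose that $\gamma_1(X_1|\mathcal I^{\mathbb X})=\infty$ a.s. Then, almost surely, $X_{k_n:n}\ne0$ for all sufficiently large $n$, and $$\frac{S(k_n,n,a)}{n\,X_{k_n:n}}\longrightarrow 0\qquad (n\to\infty).$$ Let moreover $(N(t),t\ge0)$ be a process of non-negative integer-valued random variables on $\Omega$, let $Z$ be an almost surely positive (real) random variable on $\Omega$, let $c$ be a positive function on $(0,\infty)$ with $c(t)\to\infty$ as $t\to\infty$, and suppose that $N(t)/c(t)\to Z$ a.s. as $t\to\infty$. Then, almost surely, $N(t)\ge1$ and $X_{k_{N(t)}:N(t)}\ne0$ for all sufficiently large $t$, and $$\frac{\mathcal S_t(k_{N(t)},a)}{c(t)\,X_{k_{N(t)}:N(t)}}\longrightarrow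 0\qquad (t\to\infty).$$ -/

import Mathlib

open MeasureTheory ProbabilityTheory Filter
open scoped Topology NNReal

/-
Sequences are indexed from `0` : the entry `X i` of a sequence `X : ℕ → Ω → ℝ` is the random
variable that is usually called `X_{i+1}`, so that `X_1, …, X_n` are the entries with index in
`Finset.range n`.
-/

namespace NearMax

/-- The `k`-th order statistic `x_{k:n}`, that is the `k`-th smallest value (with repetitions)
among the first `n` entries of `x`, for `1 ≤ k ≤ n`. Outside that range the value is `0`. -/
noncomputable def orderStat (x : ℕ → ℝ) (k n : ℕ) : ℝ :=
  if h : 1 ≤ k ∧ k ≤ n then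
    x (Tuple.sort (fun i : Fin n => x i) ⟨k - 1, by omega⟩ : Fin n)
  else 0

/-- The sum `S(k,n,a)` of those among the first `n` entries of `x` that lie in the open interval
`(x_{k:n} - a, x_{k:n})`. -/
noncomputable def nearSum (x : ℕ → ℝ) (k n : ℕ) (a : ℝ) : ℝ :=
  ∑ i ∈ Finset.range n,
    Set.indicator (Set.Ioo (orderStat x k n - a) (orderStat x k n)) (fun y => y) (x i)

/-- `1 ≤ k_n ≤ n` for all `n ≥ 1`, and `k_n / n → 1`. -/
structure IsExtremeOrIntermediate (k : ℕ → ℕ) : Prop where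
  mem : ∀ n, 1 ≤ n → 1 ≤ k n ∧ k n ≤ n
  tendsto : Tendsto (fun n => (k n : ℝ) / (n : ℝ)) atTop (𝓝 1)

variable {Ω : Type*}

/-- Strict stationarity: all the shifted sequences have the same law on the space of real sequences
with its product (equivalently Borel) sigma-field. -/
def StrictlyStationary {mΩ : MeasurableSpace Ω} (μ : Measure Ω) (X : ℕ → Ω → ℝ) : Prop :=
  ∀ m : ℕ, μ.map (fun ω (i : ℕ) => X (i + m) ω) = μ.map (fun ω (i : ℕ) => X i ω)

/-- The class of the sets that are invariant with respect to the sequence `X`: those sets `A` for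
which there is one Borel set `B` of real sequences with
`A = {ω | (X_i(ω), X_{i+1}(ω), …) ∈ B}` for every `i`. -/
@[reducible] def invariantSigma (X : ℕ → Ω → ℝ) : MeasurableSpace Ω where
  MeasurableSet' A := ∃ B : Set (ℕ → ℝ), MeasurableSet B ∧
    ∀ i : ℕ, A = {ω | (fun j : ℕ => X (i + j) ω) ∈ B}
  measurableSet_empty := ⟨∅, MeasurableSet.empty, fun _ => by ext; simp⟩
  measurableSet_compl := by
    rintro A ⟨B, hB, h⟩
    refine ⟨Bᶜ, hB.compl, fun i => ?_⟩
    rw [h i]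
    rfl
  measurableSet_iUnion := by
    intro A hA
    choose B hB h using hA
    refine ⟨⋃ n, B n, MeasurableSet.iUnion hB, fun i => ?_⟩
    ext ω
    simp only [Set.mem_iUnion, Set.mem_ofPred_eq]
    refine exists_congr fun n => ?_
    rw [h n i]
    rfl

/-- For random variables the invariant sets form a sub-sigma-field of the ambient one. -/
theorem invariantSigma_le {mΩ : MeasurableSpace Ω} {X : ℕ → Ω → ℝ}
    (hX : ∀ i, Measurable (X i)) : invariantSigma X ≤ mΩ := by
  rintro A ⟨B, hB, h⟩
  rw [h 0]
  exact (measurable_pi_lambda _ fun j => hX (0 + j)) hB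

/-- `Q` is (a version of) the conditional right endpoint of the support of `Y` given the
sub-sigma-field `G`: the smallest `G`-measurable extended random variable that bounds `Y` from above
with conditional probability one. -/
structure IsCondRightEndpoint {mΩ : MeasurableSpace Ω} (μ : Measure Ω) (G : MeasurableSpace Ω)
    (Y : Ω → ℝ) (Q : Ω → EReal) : Prop where
  measurable : Measurable[G] Q
  bound : μ⟦{ω | (Y ω : EReal) ≤ Q ω} | G⟧ =ᵐ[μ] fun _ => (1 : ℝ)
  least : ∀ Q' : Ω → EReal, Measurable[G] Q' →
    μ⟦{ω | (Y ω : EReal) ≤ Q' ω} | G⟧ =ᵐ[μ] (fun _ => (1 : ℝ)) → Q ≤ᵐ[μ] Q'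

/-- The standing condition on the claim number process `N`, the random variable `Z` and the
normalizing function `c`. (The value of `c` at time `0` is left free, so that `c(t) = t` is
allowed.) -/
structure ConditionA {mΩ : MeasurableSpace Ω} (μ : Measure Ω) (N : ℝ≥0 → Ω → ℕ) (Z : Ω → ℝ)
    (c : ℝ≥0 → ℝ) : Prop where
  measurable_N : ∀ t, Measurable (N t)
  measurable_Z : Measurable Z
  Z_pos : ∀ᵐ ω ∂μ, 0 < Z ω
  c_pos : ∀ t, 0 < t → 0 < c t
  c_tendsto : Tendsto c atTop atTop

end NearMax

/-! Everything rests on how often the path exceeds a level `v`. High levels are rarely exceeded: by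
the maximal inequality, almost surely each ε > 0 admits a `v` with at most εn exceedances among the
first n entries, for all n (`ae_exists_forall_exceedCount_le`). Yet every fixed `v` is exceeded with
positive lower frequency. Paths where this fails form a shift-invariant set, on which the maximal
ergodic theorem forces X_0 ≤ v; an invariant bound finite on a non-null set would contradict the
infinite conditional endpoint (`ae_notMem_rareExceed`). Since k_n/n → 1, the second fact sends M =
X_{k_n:n} to infinity. Once M ≥ v + a, each summand lies in [0, M] and exceeds `v`, so |S| ≤ εnM.
Only one-sided frequency bounds are used, never convergence of frequencies. Random sample sizes
follow pathwise, as N(t) → ∞. -/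

namespace NearMax

/-! ### Maximal ergodic theorem and visit frequencies -/

section MaximalErgodic

variable {α : Type*}

/-- The maximum of the Birkhoff sums of `f` of lengths `0, …, n`. -/
noncomputable def birkhoffMax (T : α → α) (f : α → ℝ) : ℕ → α → ℝ
  | 0, _ => 0
  | n + 1, x => max 0 (f x + birkhoffMax T f n (T x))

theorem birkhoffMax_nonneg (T : α → α) (f : α → ℝ) (n : ℕ) (x : α) :
    0 ≤ birkhoffMax T f n x := by
  cases n with
  | zero => exact le_rfl
  | succ n => exact le_max_left _ _

theorem birkhoffMax_le_succ (T : α → α) (f : α → ℝ) (n : ℕ) (x : α) :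
    birkhoffMax T f n x ≤ birkhoffMax T f (n + 1) x := by
  induction n generalizing x with
  | zero => exact birkhoffMax_nonneg T f 1 x
  | succ n ih => exact max_le_max le_rfl (add_le_add le_rfl (ih (T x)))

theorem birkhoffMax_le_add (T : α → α) (f : α → ℝ) (n : ℕ) (x : α)
    (hx : 0 < birkhoffMax T f n x) :
    birkhoffMax T f n x ≤ f x + birkhoffMax T f n (T x) := by
  cases n with
  | zero => exact absurd hx (lt_irrefl _)
  | succ n =>
    have h := birkhoffMax_le_succ T f n (T x)
    rcases lt_max_iff.1 hx with h0 | h0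
    · exact absurd h0 (lt_irrefl _)
    · rw [show birkhoffMax T f (n + 1) x = max 0 (f x + birkhoffMax T f n (T x)) from rfl,
        max_eq_right h0.le]
      exact add_le_add le_rfl h

theorem birkhoffSum_le_birkhoffMax (T : α → α) (f : α → ℝ) (n : ℕ) (x : α) :
    birkhoffSum T f n x ≤ birkhoffMax T f n x := by
  induction n generalizing x with
  | zero => exact (birkhoffSum_zero T f x).le
  | succ n ih =>
    rw [birkhoffSum_succ']
    exact (add_le_add le_rfl (ih (T x))).trans (le_max_right _ _)

theorem exists_birkhoffMax_eq (T : α → α) (f : α → ℝ) (n : ℕ) (x : α) :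
    ∃ m, birkhoffMax T f n x = birkhoffSum T f m x := by
  induction n generalizing x with
  | zero => exact ⟨0, (birkhoffSum_zero T f x).symm⟩
  | succ n ih =>
    obtain ⟨m, hm⟩ := ih (T x)
    rcases max_choice 0 (f x + birkhoffMax T f n (T x)) with h | h
    · exact ⟨0, h.trans (birkhoffSum_zero T f x).symm⟩
    · exact ⟨m + 1, by rw [birkhoffSum_succ', ← hm]; exact h⟩

theorem iUnion_birkhoffMax_pos (T : α → α) (f : α → ℝ) :
    ⋃ n, {x | 0 < birkhoffMax T f n x} = {x | ∃ n, 0 < birkhoffSum T f n x} := by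
  ext x
  simp only [Set.mem_iUnion, Set.mem_ofPred_eq]
  constructor
  · rintro ⟨n, hn⟩
    obtain ⟨m, hm⟩ := exists_birkhoffMax_eq T f n x
    exact ⟨m, hm ▸ hn⟩
  · rintro ⟨n, hn⟩
    exact ⟨n, hn.trans_le (birkhoffSum_le_birkhoffMax T f n x)⟩

variable [MeasurableSpace α] {ν : Measure α} {T : α → α} {f : α → ℝ}

theorem measurable_birkhoffMax (hT : Measurable T) (hf : Measurable f) (n : ℕ) :
    Measurable (birkhoffMax T f n) := by
  induction n with
  | zero => exact measurable_const
  | succ n ih => exact measurable_const.max (hf.add (ih.comp hT))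

theorem integrable_birkhoffMax (hT : MeasurePreserving T ν ν) (hf : Integrable f ν) (n : ℕ) :
    Integrable (birkhoffMax T f n) ν := by
  induction n with
  | zero => exact integrable_zero _ _ _
  | succ n ih =>
    exact (integrable_zero _ _ _).sup (hf.add (hT.integrable_comp_of_integrable ih))

/-- Garsia's argument: on {M > 0} one has f ≥ M - M ∘ T. The right side has total integral zero by
invariance, and off that set it is at most zero. -/
theorem setIntegral_birkhoffMax_pos_nonneg (hT : MeasurePreserving T ν ν) (hf : Measurable f)
    (hfi : Integrable f ν) (n : ℕ) : 0 ≤ ∫ x in {x | 0 < birkhoffMax T f n x}, f x ∂ν := by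
  set M := birkhoffMax T f n with hM
  have hMm : Measurable M := measurable_birkhoffMax hT.measurable hf n
  have hMi : Integrable M ν := integrable_birkhoffMax hT hfi n
  have hMTi : Integrable (fun x => M (T x)) ν := hT.integrable_comp_of_integrable hMi
  have hE : MeasurableSet {x | 0 < M x} := measurableSet_lt measurable_const hMm
  have h1 : ∫ x in {x | 0 < M x}, (M x - M (T x)) ∂ν ≤ ∫ x in {x | 0 < M x}, f x ∂ν := by
    refine setIntegral_mono_on (hMi.sub hMTi).integrableOn hfi.integrableOn hE fun x hx => ?_
    linarith [birkhoffMax_le_add T f n x hx]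
  have h2 : ∫ x, (M x - M (T x)) ∂ν = 0 := by
    have : ∫ x, M (T x) ∂ν = ∫ x, M x ∂ν := by
      conv_rhs => rw [← hT.map_eq]
      exact (integral_map hT.aemeasurable hMm.aestronglyMeasurable).symm
    rw [integral_sub hMi hMTi, this, sub_self]
  have h3 : ∫ x in {x | 0 < M x}ᶜ, (M x - M (T x)) ∂ν ≤ 0 := by
    refine setIntegral_nonpos hE.compl fun x hx => ?_
    have hx' : M x ≤ 0 := not_lt.1 hx
    linarith [birkhoffMax_nonneg T f n (T x)]
  have h4 := integral_add_compl hE (hMi.sub hMTi)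
  simp only [Pi.sub_apply] at h4
  linarith

/-- The maximal ergodic theorem. -/
theorem setIntegral_exists_birkhoffSum_pos_nonneg (hT : MeasurePreserving T ν ν)
    (hf : Measurable f) (hfi : Integrable f ν) :
    0 ≤ ∫ x in {x | ∃ n, 0 < birkhoffSum T f n x}, f x ∂ν := by
  rw [← iUnion_birkhoffMax_pos]
  refine ge_of_tendsto' (tendsto_setIntegral_of_monotone
    (fun n => measurableSet_lt measurable_const (measurable_birkhoffMax hT.measurable hf n))
    (monotone_nat_of_le_succ fun n x hx => ?_) hfi.integrableOn)
    (setIntegral_birkhoffMax_pos_nonneg hT hf hfi)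
  exact lt_of_lt_of_le hx (birkhoffMax_le_succ T f n x)

theorem measurable_birkhoffSum (hT : Measurable T) (hf : Measurable f) (n : ℕ) :
    Measurable (birkhoffSum T f n) :=
  Finset.measurable_sum _ fun i _ => hf.comp (hT.iterate i)

variable [IsFiniteMeasure ν] {A : Set α}

/-- The maximal inequality for the visits to a set. -/
theorem mul_measureReal_exists_lt_birkhoffSum_le (hT : MeasurePreserving T ν ν)
    (hA : MeasurableSet A) (c : ℝ) :
    c * ν.real {x | ∃ n : ℕ, c * n < birkhoffSum T (A.indicator 1) n x} ≤ ν.real A := by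
  have hf : Measurable (A.indicator (1 : α → ℝ)) := measurable_one.indicator hA
  have hfi : Integrable (A.indicator (1 : α → ℝ)) ν := (integrable_const (1 : ℝ)).indicator hA
  have hci : Integrable (fun _ : α => c) ν := integrable_const c
  have h := setIntegral_exists_birkhoffSum_pos_nonneg hT (hf.sub (measurable_const (a := c)))
    (hfi.sub hci)
  have hE : {x | ∃ n, 0 < birkhoffSum T (A.indicator (1 : α → ℝ) - fun _ => c) n x} =
      {x | ∃ n : ℕ, c * n < birkhoffSum T (A.indicator 1) n x} := by
    ext x
    refine exists_congr fun n => ?_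
    rw [birkhoffSum_sub]
    simp [birkhoffSum, mul_comm]
  rw [hE] at h
  simp only [Pi.sub_apply] at h
  rw [integral_sub hfi.integrableOn hci.integrableOn, integral_indicator_one hA,
    setIntegral_const, smul_eq_mul, measureReal_restrict_apply hA] at h
  have := measureReal_mono (μ := ν) (Set.inter_subset_left (s := A)
    (t := {x | ∃ n : ℕ, c * n < birkhoffSum T (A.indicator 1) n x}))
  linarith

/-- On an invariant set on which the frequency of the visits to `A` comes arbitrarily close to
zero, there are no points of `A`. -/
theorem measure_inter_eq_zero_of_birkhoffSum_lt (hT : MeasurePreserving T ν ν)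
    (hA : MeasurableSet A) {B : Set α} (hB : MeasurableSet B) (hTB : T ⁻¹' B = B)
    (h : ∀ x ∈ B, ∀ ε : ℝ, 0 < ε → ∃ n : ℕ, birkhoffSum T (A.indicator 1) n x < ε * n) :
    ν (A ∩ B) = 0 := by
  have key : ∀ ε : ℝ, 0 < ε → ν.real (A ∩ B) ≤ ε * ν.real B := by
    intro ε hε
    have hf : Measurable (A.indicator (1 : α → ℝ)) := measurable_one.indicator hA
    have hfi : Integrable (A.indicator (1 : α → ℝ)) ν := (integrable_const (1 : ℝ)).indicator hA
    have hci : Integrable (fun _ : α => ε) ν := integrable_const ε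
    set g : α → ℝ := (fun _ => ε) - A.indicator (1 : α → ℝ) with hg
    -- Invariance of `B` and the hypothesis make `B` exactly the set where some Birkhoff sum of
    -- `B.indicator g` is positive, so this reads 0 ≤ ε ν(B) - ν(A ∩ B).
    have h0 := setIntegral_exists_birkhoffSum_pos_nonneg hT
      ((measurable_const.sub hf).indicator hB : Measurable (B.indicator g))
      ((hci.sub hfi).indicator hB)
    have hiter : ∀ (i : ℕ) (x : α), T^[i] x ∈ B ↔ x ∈ B := by
      intro i
      induction i with
      | zero => simp
      | succ i ih =>
        intro x
        rw [Function.iterate_succ_apply, ih]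
        exact Set.ext_iff.1 hTB x
    have hE : {x | ∃ n, 0 < birkhoffSum T (B.indicator g) n x} = B := by
      ext x
      by_cases hx : x ∈ B
      · obtain ⟨n, hn⟩ := h x hx ε hε
        refine iff_of_true ⟨n, ?_⟩ hx
        have : birkhoffSum T (B.indicator g) n x = birkhoffSum T g n x :=
          Finset.sum_congr rfl fun i _ => Set.indicator_of_mem ((hiter i x).2 hx) _
        rw [this, hg, birkhoffSum_sub]
        simp only [birkhoffSum, Finset.sum_const, Finset.card_range, nsmul_eq_mul] at hn ⊢
        linarith
      · refine iff_of_false ?_ hx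
        rintro ⟨n, hn⟩
        have : birkhoffSum T (B.indicator g) n x = 0 :=
          Finset.sum_eq_zero fun i _ =>
            Set.indicator_of_notMem (fun hi => hx ((hiter i x).1 hi)) _
        exact hn.ne' this
    rw [hE, setIntegral_indicator hB, Set.inter_self] at h0
    simp only [Pi.sub_apply] at h0
    rw [integral_sub hci.integrableOn hfi.integrableOn, integral_indicator_one hA,
      setIntegral_const, smul_eq_mul, measureReal_restrict_apply hA] at h0
    linarith
  have hle : ν.real (A ∩ B) ≤ 0 := by
    have ht : Tendsto (fun ε : ℝ => ε * ν.real B) (𝓝[>] 0) (𝓝 0) := by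
      have : Tendsto (fun ε : ℝ => ε * ν.real B) (𝓝 0) (𝓝 (0 * ν.real B)) :=
        tendsto_id.mul_const _
      rw [zero_mul] at this
      exact this.mono_left nhdsWithin_le_nhds
    exact ge_of_tendsto ht (eventually_mem_nhdsWithin.mono key)
  exact (measureReal_eq_zero_iff).1 (le_antisymm hle measureReal_nonneg)

end MaximalErgodic

end NearMax

namespace NearMax

/-! ### Exceedance frequencies on path space -/

section Paths

/-- The shift on the space of real sequences. -/
def pathShift (x : ℕ → ℝ) : ℕ → ℝ := fun i => x (i + 1)

theorem measurable_pathShift : Measurable pathShift :=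
  measurable_pi_lambda _ fun i => measurable_pi_apply (i + 1)

theorem iterate_pathShift (m : ℕ) (x : ℕ → ℝ) : pathShift^[m] x = fun i => x (m + i) := by
  induction m generalizing x with
  | zero => simp
  | succ m ih =>
    rw [Function.iterate_succ_apply, ih]
    funext i
    exact congrArg x (by ring)

/-- The number of the first `n` entries of `x` that exceed the level `v`. -/
noncomputable def exceedCount (v : ℝ) (x : ℕ → ℝ) (n : ℕ) : ℕ :=
  ((Finset.range n).filter fun i => v < x i).card

theorem birkhoffSum_exceed (v : ℝ) (x : ℕ → ℝ) (n : ℕ) :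
    birkhoffSum pathShift ({y : ℕ → ℝ | v < y 0}.indicator (1 : (ℕ → ℝ) → ℝ)) n x =
      exceedCount v x n := by
  rw [exceedCount, Finset.card_filter, Nat.cast_sum]
  refine Finset.sum_congr rfl fun i _ => ?_
  rw [iterate_pathShift]
  simp [Set.indicator_apply]

theorem measurableSet_exceed (v : ℝ) : MeasurableSet {y : ℕ → ℝ | v < y 0} :=
  measurableSet_lt measurable_const (measurable_pi_apply 0)

theorem measurable_exceedCount (v : ℝ) (n : ℕ) :
    Measurable fun x : ℕ → ℝ => (exceedCount v x n : ℝ) := by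
  simp_rw [← birkhoffSum_exceed]
  exact measurable_birkhoffSum measurable_pathShift
    (measurable_one.indicator (measurableSet_exceed v)) n

theorem abs_exceedCount_pathShift_sub_le (v : ℝ) (x : ℕ → ℝ) (n : ℕ) :
    |(exceedCount v (pathShift x) n : ℝ) - exceedCount v x n| ≤ 1 := by
  rw [← birkhoffSum_exceed, ← birkhoffSum_exceed, birkhoffSum_apply_sub_birkhoffSum]
  simp only [Set.indicator_apply, Pi.one_apply]
  split_ifs <;> norm_num

/-- The sequences whose entries exceed `v` with lower frequency zero. -/
def rareExceed (v : ℝ) : Set (ℕ → ℝ) :=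
  {x | ∀ m : ℕ, ∃ᶠ n : ℕ in atTop, (exceedCount v x n : ℝ) * (m + 1) < n}

theorem measurableSet_rareExceed (v : ℝ) : MeasurableSet (rareExceed v) := by
  have : rareExceed v = ⋂ m : ℕ, ⋂ N : ℕ, ⋃ n : ℕ, ⋃ _ : N ≤ n,
      {x : ℕ → ℝ | (exceedCount v x n : ℝ) * (m + 1) < n} := by
    ext x
    simp [rareExceed, frequently_atTop]
  rw [this]
  exact MeasurableSet.iInter fun m => MeasurableSet.iInter fun N => MeasurableSet.iUnion fun n =>
    MeasurableSet.iUnion fun _ =>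
      measurableSet_lt ((measurable_exceedCount v n).mul_const _) measurable_const

theorem rareExceed_of_abs_sub_le {v : ℝ} {x y : ℕ → ℝ}
    (h : ∀ n, |(exceedCount v y n : ℝ) - exceedCount v x n| ≤ 1) (hx : x ∈ rareExceed v) :
    y ∈ rareExceed v := by
  intro m
  -- Doubling m + 1 leaves room n/2, which absorbs the extra m + 1 caused by one more exceedance.
  refine ((hx (2 * m + 1)).and_eventually (eventually_ge_atTop (2 * (m + 1)))).mono ?_
  rintro n ⟨hn, hmn⟩
  have h1 := (abs_le.1 (h n)).2
  have hmn' : (2 * (m + 1) : ℝ) ≤ n := by exact_mod_cast hmn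
  have hm : (0 : ℝ) ≤ m := m.cast_nonneg
  push_cast at hn
  nlinarith

theorem preimage_pathShift_rareExceed (v : ℝ) :
    pathShift ⁻¹' rareExceed v = rareExceed v := by
  refine Set.ext fun x => ⟨fun hx => ?_, fun hx => ?_⟩
  · refine rareExceed_of_abs_sub_le (x := pathShift x) (fun n => ?_) hx
    rw [abs_sub_comm]
    exact abs_exceedCount_pathShift_sub_le v x n
  · exact Set.mem_preimage.2
      (rareExceed_of_abs_sub_le (abs_exceedCount_pathShift_sub_le v x) hx)

theorem exists_eventually_le_exceedCount {v : ℝ} {x : ℕ → ℝ} (hx : x ∉ rareExceed v) :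
    ∃ ε : ℝ, 0 < ε ∧ ∀ᶠ n : ℕ in atTop, ε * n ≤ exceedCount v x n := by
  simp only [rareExceed, Set.mem_ofPred_eq, not_forall, not_frequently, not_lt] at hx
  obtain ⟨m, hm⟩ := hx
  have hm0 : (0 : ℝ) < m + 1 := by positivity
  refine ⟨(m + 1 : ℝ)⁻¹, inv_pos.2 hm0, hm.mono fun n hn => ?_⟩
  rw [inv_mul_le_iff₀ hm0, mul_comm]
  exact hn

variable {ν : Measure (ℕ → ℝ)} [IsFiniteMeasure ν]

theorem measure_exceed_inter_rareExceed (hT : MeasurePreserving pathShift ν ν) (v : ℝ) :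
    ν ({y | v < y 0} ∩ rareExceed v) = 0 := by
  refine measure_inter_eq_zero_of_birkhoffSum_lt hT (measurableSet_exceed v)
    (measurableSet_rareExceed v) (preimage_pathShift_rareExceed v) fun x hx ε hε => ?_
  obtain ⟨m, hm⟩ := exists_nat_gt ε⁻¹
  obtain ⟨n, hn⟩ := (hx m).exists
  refine ⟨n, ?_⟩
  rw [birkhoffSum_exceed]
  have h1 : 1 < ε * (m + 1) := by
    rw [inv_lt_iff_one_lt_mul₀ hε] at hm
    nlinarith
  have h2 : (0 : ℝ) ≤ exceedCount v x n := Nat.cast_nonneg _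
  nlinarith

/-- The exceptional set lies in the maximal event of every level, so its measure is at most ν(v < y
0)/ε for all `v`, and this tends to zero. -/
theorem ae_exists_forall_exceedCount_le (hT : MeasurePreserving pathShift ν ν) {ε : ℝ}
    (hε : 0 < ε) : ∀ᵐ x ∂ν, ∃ v : ℕ, ∀ n : ℕ, (exceedCount v x n : ℝ) ≤ ε * n := by
  rw [ae_iff]
  set F : Set (ℕ → ℝ) := {x | ¬∃ v : ℕ, ∀ n : ℕ, (exceedCount v x n : ℝ) ≤ ε * n} with hF
  have hle : ∀ v : ℕ, ε * ν.real F ≤ ν.real {y : ℕ → ℝ | (v : ℝ) < y 0} := by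
    intro v
    refine le_trans (mul_le_mul_of_nonneg_left (measureReal_mono ?_) hε.le)
      (mul_measureReal_exists_lt_birkhoffSum_le hT (measurableSet_exceed v) ε)
    intro x hx
    simp only [hF, Set.mem_ofPred_eq, not_exists, not_forall, not_le] at hx
    obtain ⟨n, hn⟩ := hx v
    exact ⟨n, by rwa [birkhoffSum_exceed]⟩
  have hlim : Tendsto (fun v : ℕ => ν.real {y : ℕ → ℝ | (v : ℝ) < y 0}) atTop (𝓝 0) := by
    have hempty : ⋂ v : ℕ, {y : ℕ → ℝ | (v : ℝ) < y 0} = ∅ := by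
      refine Set.eq_empty_of_forall_notMem fun y hy => ?_
      obtain ⟨v, hv⟩ := exists_nat_gt (y 0)
      exact lt_asymm hv (Set.mem_iInter.1 hy v)
    have := tendsto_measure_iInter_atTop (μ := ν)
      (s := fun v : ℕ => {y : ℕ → ℝ | (v : ℝ) < y 0})
      (fun v => (measurableSet_exceed v).nullMeasurableSet)
      (fun u v huv y (hy : (v : ℝ) < y 0) => lt_of_le_of_lt (b := (v : ℝ)) (Nat.cast_le.2 huv) hy) ⟨0, measure_ne_top _ _⟩
    rw [hempty, measure_empty] at this
    exact (ENNReal.tendsto_toReal ENNReal.zero_ne_top).comp this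
  have h0 : ε * ν.real F ≤ 0 := ge_of_tendsto' hlim hle
  have h1 : ν.real F ≤ 0 := by
    by_contra h
    exact absurd h0 (not_le.2 (mul_pos hε (not_le.1 h)))
  exact (measureReal_eq_zero_iff).1 (le_antisymm h1 measureReal_nonneg)

end Paths

/-! ### Order statistics and near-maxima sums -/

section OrderStatistics

theorem exceedCount_add_le_of_orderStat_le {x : ℕ → ℝ} {k n : ℕ} {v : ℝ} (hk : 1 ≤ k)
    (hkn : k ≤ n) (h : orderStat x k n ≤ v) : exceedCount v x n + k ≤ n := by
  rw [orderStat, dif_pos ⟨hk, hkn⟩] at h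
  set f : Fin n → ℝ := fun i => x i
  -- In the sorted tuple, position k - 1 holds a value ≤ v exactly when more than k - 1 entries are
  -- ≤ v.
  have h1 := (Tuple.lt_card_le_iff_apply_le_of_monotone (j := ⟨k - 1, by omega⟩) (a := v)
    (Tuple.monotone_sort f)).2 h
  have h2 : (Finset.univ.filter fun i => (f ∘ Tuple.sort f) i ≤ v).card =
      (Finset.univ.filter fun i => f i ≤ v).card := by
    simp only [Finset.card_filter, Function.comp_apply]
    exact Equiv.sum_comp (Tuple.sort f) fun i => if f i ≤ v then 1 else 0
  have h3 : (Finset.univ.filter fun i => f i ≤ v).card =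
      ((Finset.range n).filter fun i => x i ≤ v).card := by
    simp only [Finset.card_filter]
    exact Fin.sum_univ_eq_sum_range (fun i => if x i ≤ v then 1 else 0) n
  have h4 := Finset.card_filter_add_card_filter_not (s := Finset.range n) fun i => x i ≤ v
  simp only [not_le, Finset.card_range] at h4
  rw [h2, h3] at h1
  rw [exceedCount]
  simp only at h1
  omega

variable {k : ℕ → ℕ} {x : ℕ → ℝ}

/-- Otherwise at most n - k_n = o(n) entries would exceed `v`, against the lower bound εn. -/
theorem eventually_lt_orderStat (hk : IsExtremeOrIntermediate k) {v : ℝ}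
    (hx : x ∉ rareExceed v) : ∀ᶠ n in atTop, v < orderStat x (k n) n := by
  obtain ⟨ε, hε, hc⟩ := exists_eventually_le_exceedCount hx
  have h1 : ∀ᶠ n : ℕ in atTop, 1 - ε < (k n : ℝ) / n :=
    hk.tendsto.eventually (lt_mem_nhds (by linarith))
  filter_upwards [hc, h1, eventually_ge_atTop 1] with n hn hkn hn1
  by_contra hlt
  obtain ⟨hk1, hk2⟩ := hk.mem n hn1
  have h2 : ((exceedCount v x n + k n : ℕ) : ℝ) ≤ n :=
    Nat.cast_le.2 (exceedCount_add_le_of_orderStat_le hk1 hk2 (not_lt.1 hlt))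
  have hn0 : (0 : ℝ) < n := by exact_mod_cast hn1
  rw [lt_div_iff₀ hn0] at hkn
  push_cast at h2
  linarith

theorem abs_nearSum_le {j n : ℕ} {a v : ℝ} (ha : 0 ≤ a) (hv : 0 ≤ v)
    (h : v + a ≤ orderStat x j n) :
    |nearSum x j n a| ≤ exceedCount v x n * orderStat x j n := by
  set M := orderStat x j n with hM
  have hrhs : (exceedCount v x n : ℝ) * M =
      ∑ i ∈ Finset.range n, if v < x i then M else 0 := by
    rw [← Finset.sum_filter, Finset.sum_const, nsmul_eq_mul, exceedCount]
  rw [hrhs, nearSum, ← hM]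
  refine (Finset.abs_sum_le_sum_abs _ _).trans (Finset.sum_le_sum fun i _ => ?_)
  by_cases hi : x i ∈ Set.Ioo (M - a) M
  · have h1 : v < x i := by linarith [hi.1]
    rw [Set.indicator_of_mem hi, if_pos h1, abs_of_nonneg (by linarith)]
    exact hi.2.le
  · rw [Set.indicator_of_notMem hi, abs_zero]
    split_ifs with h1
    · linarith
    · exact le_rfl

end OrderStatistics

end NearMax

namespace NearMax

theorem tendsto_nearSum_div {k : ℕ → ℕ} {x : ℕ → ℝ} (hk : IsExtremeOrIntermediate k) {a : ℝ}
    (ha : 0 ≤ a) (hx : ∀ v : ℕ, x ∉ rareExceed v)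
    (hε : ∀ m : ℕ, ∃ v : ℕ, ∀ n : ℕ, (exceedCount v x n : ℝ) ≤ 1 / ((m : ℝ) + 1) * n) :
    Tendsto (fun n : ℕ => nearSum x (k n) n a / ((n : ℝ) * orderStat x (k n) n))
      atTop (𝓝 0) := by
  rw [Metric.tendsto_nhds]
  intro ε hε0
  obtain ⟨m, hm⟩ := exists_nat_one_div_lt hε0
  obtain ⟨v, hv⟩ := hε m
  -- Only natural levels are controlled, so v + a is rounded up.
  obtain ⟨u, hu⟩ := exists_nat_ge ((v : ℝ) + a)
  filter_upwards [eventually_lt_orderStat hk (hx u), eventually_ge_atTop 1] with n hn hn1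
  have hv0 : (0 : ℝ) ≤ v := v.cast_nonneg
  have hn0 : (0 : ℝ) < n := by exact_mod_cast hn1
  have hM : 0 < orderStat x (k n) n := by linarith
  have hS := abs_nearSum_le ha hv0 (hu.trans hn.le)
  rw [Real.dist_eq, sub_zero, abs_div, abs_of_pos (mul_pos hn0 hM)]
  refine lt_of_le_of_lt ?_ hm
  rw [div_le_iff₀ (mul_pos hn0 hM), ← mul_assoc]
  exact hS.trans (mul_le_mul_of_nonneg_right (hv n) hM.le)

/-! ### Transfer to stationary sequences -/

section StationarySequences

variable {Ω : Type*} {mΩ : MeasurableSpace Ω} {μ : Measure Ω} {X : ℕ → Ω → ℝ}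

theorem measurePreserving_pathShift (hX : ∀ i, Measurable (X i)) (hstat : StrictlyStationary μ X) :
    MeasurePreserving pathShift (μ.map fun ω i => X i ω) (μ.map fun ω i => X i ω) := by
  refine ⟨measurable_pathShift, ?_⟩
  rw [Measure.map_map measurable_pathShift (measurable_pi_lambda _ hX)]
  exact hstat 1

theorem measurableSet_invariantSigma_rareExceed (X : ℕ → Ω → ℝ) (v : ℝ) :
    MeasurableSet[invariantSigma X] {ω | (fun i => X i ω) ∈ rareExceed v} := by
  refine ⟨rareExceed v, measurableSet_rareExceed v, fun i => Set.ext fun ω => ?_⟩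
  have h : ∀ (i : ℕ) (x : ℕ → ℝ), (fun j => x (i + j)) ∈ rareExceed v ↔ x ∈ rareExceed v := by
    intro i
    induction i with
    | zero => simp
    | succ i ih =>
      intro x
      rw [← iterate_pathShift, Function.iterate_succ_apply, iterate_pathShift, ih]
      exact Set.ext_iff.1 (preimage_pathShift_rareExceed v) x
  exact (h i fun j => X j ω).symm

variable [IsProbabilityMeasure μ]

/-- The function equal to `v` on the invariant event and ⊤ elsewhere is an admissible bound for X_0,
so minimality of γ = ⊤ makes the event null. -/
theorem ae_notMem_rareExceed (hX : ∀ i, Measurable (X i)) (hstat : StrictlyStationary μ X)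
    {γ : Ω → EReal} (hγ : IsCondRightEndpoint μ (invariantSigma X) (X 0) γ)
    (hγ_top : ∀ᵐ ω ∂μ, γ ω = ⊤) (v : ℝ) :
    ∀ᵐ ω ∂μ, (fun i => X i ω) ∉ rareExceed v := by
  classical
  have hpath : Measurable fun ω i => X i ω := measurable_pi_lambda _ hX
  have : IsProbabilityMeasure (μ.map fun ω i => X i ω) :=
    Measure.isProbabilityMeasure_map hpath.aemeasurable
  set A : Set Ω := {ω | (fun i => X i ω) ∈ rareExceed v} with hA
  have hAm : MeasurableSet[invariantSigma X] A := measurableSet_invariantSigma_rareExceed X v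
  have h0 := measure_exceed_inter_rareExceed (measurePreserving_pathShift hX hstat) v
  rw [Measure.map_apply hpath ((measurableSet_exceed v).inter (measurableSet_rareExceed v))] at h0
  set Q : Ω → EReal := A.piecewise (fun _ => (v : EReal)) fun _ => ⊤ with hQ
  have hQm : Measurable[invariantSigma X] Q :=
    Measurable.piecewise hAm measurable_const measurable_const
  have hae : ({ω | (X 0 ω : EReal) ≤ Q ω}.indicator fun _ => (1 : ℝ)) =ᵐ[μ] fun _ => 1 := by
    filter_upwards [measure_eq_zero_iff_ae_notMem.1 h0] with ω hω
    refine Set.indicator_of_mem (s := {ω | (X 0 ω : EReal) ≤ Q ω}) ?_ _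
    by_cases hωA : ω ∈ A
    · have : X 0 ω ≤ v := not_lt.1 fun hlt => hω ⟨hlt, hωA⟩
      simpa [hQ, Set.piecewise_eq_of_mem _ _ _ hωA] using this
    · simp [hQ, Set.piecewise_eq_of_notMem _ _ _ hωA]
  have hone : μ⟦{ω | (X 0 ω : EReal) ≤ Q ω} | invariantSigma X⟧ =ᵐ[μ] fun _ => (1 : ℝ) := by
    refine (condExp_congr_ae hae).trans ?_
    rw [condExp_const (invariantSigma_le hX)]
  filter_upwards [hγ.least Q hQm hone, hγ_top] with ω hle htop hωA
  rw [htop, hQ, Set.piecewise_eq_of_mem _ _ _ (show ω ∈ A from hωA)] at hle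
  exact EReal.coe_ne_top v (top_le_iff.1 hle)

theorem ae_forall_exists_forall_exceedCount_le (hX : ∀ i, Measurable (X i))
    (hstat : StrictlyStationary μ X) :
    ∀ᵐ ω ∂μ, ∀ m : ℕ, ∃ v : ℕ, ∀ n : ℕ,
      (exceedCount v (fun i => X i ω) n : ℝ) ≤ 1 / ((m : ℝ) + 1) * n := by
  have hpath : Measurable fun ω i => X i ω := measurable_pi_lambda _ hX
  have : IsProbabilityMeasure (μ.map fun ω i => X i ω) :=
    Measure.isProbabilityMeasure_map hpath.aemeasurable
  refine ae_all_iff.2 fun m => ae_of_ae_map hpath.aemeasurable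
    (p := fun x => ∃ v : ℕ, ∀ n : ℕ, (exceedCount v x n : ℝ) ≤ 1 / ((m : ℝ) + 1) * n) ?_
  exact ae_exists_forall_exceedCount_le (measurePreserving_pathShift hX hstat)
    Nat.one_div_pos_of_nat

/-- The conclusion for deterministic sample sizes. -/
theorem ae_orderStat_ne_zero_and_tendsto (hX : ∀ i, Measurable (X i))
    (hstat : StrictlyStationary μ X) {k : ℕ → ℕ} (hk : IsExtremeOrIntermediate k) {a : ℝ}
    (ha : 0 < a) {γ : Ω → EReal} (hγ : IsCondRightEndpoint μ (invariantSigma X) (X 0) γ)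
    (hγ_top : ∀ᵐ ω ∂μ, γ ω = ⊤) :
    ∀ᵐ ω ∂μ,
      (∀ᶠ n : ℕ in atTop, orderStat (fun i => X i ω) (k n) n ≠ 0) ∧
      Tendsto (fun n : ℕ => nearSum (fun i => X i ω) (k n) n a /
          ((n : ℝ) * orderStat (fun i => X i ω) (k n) n)) atTop (𝓝 0) := by
  have h1 : ∀ᵐ ω ∂μ, ∀ v : ℕ, (fun i => X i ω) ∉ rareExceed v :=
    ae_all_iff.2 fun v => ae_notMem_rareExceed hX hstat hγ hγ_top v
  filter_upwards [h1, ae_forall_exists_forall_exceedCount_le hX hstat] with ω hω hε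
  refine ⟨(eventually_lt_orderStat hk (hω 0)).mono fun n hn => ?_,
    tendsto_nearSum_div hk ha.le hω hε⟩
  rw [Nat.cast_zero] at hn
  exact hn.ne'

end StationarySequences

/-- Passing from sample sizes `n` to random sample sizes `N t` comparable with `c t`. -/
theorem tendsto_div_of_tendsto_natCast_div {S M : ℕ → ℝ}
    (h : Tendsto (fun n : ℕ => S n / ((n : ℝ) * M n)) atTop (𝓝 0)) {N : ℝ≥0 → ℕ} {c : ℝ≥0 → ℝ}
    {z : ℝ} (hN : Tendsto N atTop atTop)
    (hz : Tendsto (fun t => (N t : ℝ) / c t) atTop (𝓝 z)) :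
    Tendsto (fun t => S (N t) / (c t * M (N t))) atTop (𝓝 0) := by
  have h1 := (h.comp hN).mul hz
  rw [zero_mul] at h1
  refine h1.congr' ?_
  filter_upwards [hN.eventually_ge_atTop 1] with t ht
  have hN0 : (N t : ℝ) ≠ 0 := by
    have : N t ≠ 0 := by omega
    exact_mod_cast this
  simp only [Function.comp_apply]
  -- Only `N t` is cancelled, so neither `c t` nor `M (N t)` has to be nonzero.
  rw [div_mul_div_comm, mul_right_comm, mul_comm (S (N t)), mul_assoc (N t : ℝ),
    mul_div_mul_left _ _ hN0]

theorem tendsto_atTop_of_tendsto_natCast_div {N : ℝ≥0 → ℕ} {c : ℝ≥0 → ℝ} {z : ℝ}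
    (hc : Tendsto c atTop atTop) (hz0 : 0 < z)
    (hz : Tendsto (fun t => (N t : ℝ) / c t) atTop (𝓝 z)) : Tendsto N atTop atTop := by
  refine tendsto_natCast_atTop_iff.1 ((hz.pos_mul_atTop hz0 hc).congr' ?_)
  filter_upwards [hc.eventually_gt_atTop 0] with t ht
  exact div_mul_cancel₀ _ ht.ne'

end NearMax

theorem theorem4p4 {Ω : Type*} {mΩ : MeasurableSpace Ω} (μ : Measure Ω) [IsProbabilityMeasure μ]
    (X : ℕ → Ω → ℝ) (hX : ∀ i, Measurable (X i)) (hstat : NearMax.StrictlyStationary μ X)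
    (k : ℕ → ℕ) (hk : NearMax.IsExtremeOrIntermediate k)
    (a : ℝ) (ha : 0 < a)
    (γ : Ω → EReal) (hγ : NearMax.IsCondRightEndpoint μ (NearMax.invariantSigma X) (X 0) γ)
    (hγ_top : ∀ᵐ ω ∂μ, γ ω = ⊤) :
    -- deterministic sample size: the quotients are eventually defined, and tend to zero
    (∀ᵐ ω ∂μ,
      (∀ᶠ n : ℕ in atTop, NearMax.orderStat (fun i => X i ω) (k n) n ≠ 0) ∧
      Tendsto (fun n : ℕ =>
          NearMax.nearSum (fun i => X i ω) (k n) n a /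
            ((n : ℝ) * NearMax.orderStat (fun i => X i ω) (k n) n))
        atTop (𝓝 0)) ∧
    -- random sample size
    (∀ (N : ℝ≥0 → Ω → ℕ) (Z : Ω → ℝ) (c : ℝ≥0 → ℝ), NearMax.ConditionA μ N Z c →
      (∀ᵐ ω ∂μ, Tendsto (fun t : ℝ≥0 => (N t ω : ℝ) / c t) atTop (𝓝 (Z ω))) →
      ∀ᵐ ω ∂μ,
        (∀ᶠ t : ℝ≥0 in atTop,
          1 ≤ N t ω ∧ NearMax.orderStat (fun i => X i ω) (k (N t ω)) (N t ω) ≠ 0) ∧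
        Tendsto (fun t : ℝ≥0 =>
            NearMax.nearSum (fun i => X i ω) (k (N t ω)) (N t ω) a /
              (c t * NearMax.orderStat (fun i => X i ω) (k (N t ω)) (N t ω)))
          atTop (𝓝 0)) := by
  have hdet := NearMax.ae_orderStat_ne_zero_and_tendsto hX hstat hk ha hγ hγ_top
  refine ⟨hdet, fun N Z c hA hNZ => ?_⟩
  filter_upwards [hdet, hNZ, hA.Z_pos] with ω hω hz hZ
  have hN : Tendsto (fun t => N t ω) atTop atTop :=
    NearMax.tendsto_atTop_of_tendsto_natCast_div hA.c_tendsto hZ hz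
  exact ⟨(hN.eventually_ge_atTop 1).and (hN.eventually hω.1),
    NearMax.tendsto_div_of_tendsto_natCast_div hω.2 hN hz⟩
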